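/- Let $n\ge 1$ and let $\mathbb R^{2n+1}$, with coordinates $(x_1,\dots,x_n,y_1,\dots,y_n,z)$, carry the standard contact structure $\xi_0=\ker\alpha_0$, where $\alpha_0=dz+\sum_{i=1}^n x_i\,dy_i$. A path of diffeomorphisms of $\mathbb R^{2n+1}$ is a family $(f_t)_{t\in[0,1]}$ of $C^\infty$ diffeomorphisms such that $(t,p)\mapsto f_t(p)$ is $C^\infty$ on $[0,1]\times\mathbb R^{2n+1}$; it generates the time-dependent vector field $X^f_t$ given by $X^f_t(f_t(q))=\frac{d}{dt}f_t(q)$. It is a path of contactomorphisms if $df_t(\xi_0)=\xi_0$ for every $t\in[0,1]$, and it is called positive on a set $S\subset\mathbb R^{2n+1}$ if $\alpha_0(X^f_t)(p)>0$ for all $t\in[0,1]$ and all $p\in S$; it is called positive if it is positive on $\mathbb R^{2n+1}$. Theorem. Let $(f_t)_{t\in[0,1]}$ be a path of contactomorphisms of $(\mathbb R^{2n+1},\xi_0)$ that is positive on the complement of some compact set $K_1\subset\mathbb R^{2n+1}$. Then there exists a positive path of diffeomorphisms $(g_t)_{t\in[0,1]}$ of $\mathbb R^{2n+1}$ with $g_0=f_0$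 and $g_1=f_1$, and a compact set $K_2\supset K_1$, such that $g_t(p)=f_t(p)$ for all $t\in[0,1]$ and all $p\in\mathbb R^{2n+1}\setminus K_2$. -/

import Mathlib

open Set
open scoped Manifold ContDiff

noncomputable section

namespace StdContact

/-- The space `ℝ^{2n+1}` with coordinates `(x, y, z)`, where `x, y ∈ ℝⁿ` and `z ∈ ℝ`. -/
abbrev Space (n : ℕ) : Type := (Fin n → ℝ) × (Fin n → ℝ) × ℝ

/-- The standard contact form `α₀ = dz + ∑ i, xᵢ dyᵢ`, as a covector at each point. -/
def form (n : ℕ) (p : Space n) : Space n →L[ℝ] ℝ :=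
  let dy : Space n →L[ℝ] (Fin n → ℝ) :=
    (ContinuousLinearMap.fst ℝ (Fin n → ℝ) ℝ).comp
      (ContinuousLinearMap.snd ℝ (Fin n → ℝ) ((Fin n → ℝ) × ℝ))
  let dz : Space n →L[ℝ] ℝ :=
    (ContinuousLinearMap.snd ℝ (Fin n → ℝ) ℝ).comp
      (ContinuousLinearMap.snd ℝ (Fin n → ℝ) ((Fin n → ℝ) × ℝ))
  dz + ∑ i, p.1 i • (ContinuousLinearMap.proj (R := ℝ) (φ := fun _ : Fin n => ℝ) i).comp dy

theorem form_apply (n : ℕ) (p v : Space n) :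
    form n p v = v.2.2 + ∑ i, p.1 i * v.2.1 i := by
  simp [form]

/-- The standard contact structure `ξ₀ = ker α₀`. -/
def structureAt (n : ℕ) (p : Space n) : Submodule ℝ (Space n) :=
  LinearMap.ker (form n p).toLinearMap

/-- `C^∞` diffeomorphisms of `ℝ^{2n+1}`. -/
abbrev Diff (n : ℕ) : Type := Space n ≃ₘ[ℝ] Space n

/-- A diffeomorphism is a contactomorphism if its differential maps `ξ₀` onto `ξ₀`. -/
def IsContacto {n : ℕ} (φ : Diff n) : Prop :=
  ∀ p : Space n,
    (structureAt n p).map (fderiv ℝ φ p).toLinearMap = structureAt n (φ p)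

/-- `(f t)`, `t ∈ [0,1]`, is a smooth path of diffeomorphisms: `(t, p) ↦ f t p` is `C^∞` on
`[0,1] × ℝ^{2n+1}`. Values of `f` at times outside `[0,1]` are irrelevant. -/
def IsSmoothPath {n : ℕ} (f : ℝ → Diff n) : Prop :=
  ContDiffOn ℝ ∞ (fun q : ℝ × Space n => f q.1 q.2) (Icc (0 : ℝ) 1 ×ˢ univ)

/-- The time-dependent vector field `X_t` generated by a path of diffeomorphisms over `[0,1]`,
determined by `X_t (f t q) = d/dt (f t q)` (one-sided derivatives at the times `0` and `1`). -/
def vectorField {n : ℕ} (f : ℝ → Diff n) (t : ℝ) (p : Space n) : Space n :=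
  derivWithin (fun s => f s ((f t).symm p)) (Icc (0 : ℝ) 1) t

/-- The path is positive on `S`: `α₀ (X_t) > 0` at the points of `S`, for all `t ∈ [0,1]`. -/
def IsPositiveOn {n : ℕ} (f : ℝ → Diff n) (S : Set (Space n)) : Prop :=
  ∀ t ∈ Icc (0 : ℝ) 1, ∀ p ∈ S, 0 < form n p (vectorField f t p)

end StdContact

end

/-!
The path `g t` is obtained as `f t ∘ H t`, where `H` is a loop of diffeomorphisms of
`ℝ^{2n+1}` based at the identity and supported in a fixed compact set. Since `f t` is a
contactomorphism, `(f t)^* α₀ = λ α₀` with `λ` of constant sign (`IsSmoothPath.exists_sign`), and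
at the point `g t q`, with `p = H t q`, the form `α₀` takes on the velocity of `g` the value
`α₀ (X_t) (f t p) + λ (t, p) α₀ (∂_t H)`. So it suffices that `λ α₀ (∂_t H)` is very positive
whenever `p` lies in a large ball `B` containing all preimages `(f t)⁻¹ K₁`
(`IsSmoothPath.exists_bound_preimage`), and only slightly negative elsewhere. The support of `H` has
to be fixed before these two bounds are chosen, since the slack of `f` is only bounded below on
compact sets.

Such loops (`exists_loop`) come from the fact that `∂/∂x₁` is Legendrian, so that motion along it
costs nothing. Diffeomorphisms moving only the coordinate `x₁` squeeze `B` into a slab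
`|x₁ - c t| ≤ 1 / N` (`exists_squeeze`); the inverse squeezing spreads this slab over `B`.
As `t` increases, `c t` slides from left to right, so each point is carried through `B` only for a
time of order `1 / N`. A vertical motion `q ↦ q + σ D (t, q) ∂/∂z` which rises at a speed of order
`ε N` while `x₁` is in the slab therefore gains a total height of order `ε` only, and this is lost
again at a speed of order `ε`, uniformly in time (`exists_lift`). The loop `H` is this vertical
motion followed by the inverse squeezing, and `α₀ (∂_t H) = σ ∂_t D`. At times within `1 / N` of the
ends, where the squeezing is switched on and off, everything rises. Taking `ε` small and then `N` large
gives both bounds. Both motions are shears along a coordinate direction, which are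
diffeomorphisms as soon as they are increasing along the lines of this direction
(`exists_diffeomorph_shear`).
-/

open Set
open scoped Manifold ContDiff

namespace StdContact

/-! ### Shears along a fixed direction -/

section Shear

variable {E : Type*} [NormedAddCommGroup E] [NormedSpace ℝ E]

/-- The rank-one perturbation `v ↦ v + l v • e` of the identity, invertible when `1 + l e ≠ 0`. -/
noncomputable def shearEquiv (l : E →L[ℝ] ℝ) (e : E) (h : 1 + l e ≠ 0) : E ≃L[ℝ] E :=
  ContinuousLinearEquiv.equivOfInverse
    (ContinuousLinearMap.id ℝ E + l.smulRight e)
    (ContinuousLinearMap.id ℝ E - ((1 + l e)⁻¹ • l).smulRight e)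
    (fun v => by
      simp only [add_apply, sub_apply, ContinuousLinearMap.id_apply,
        ContinuousLinearMap.smulRight_apply, smul_apply, map_add, map_smul, smul_eq_mul]
      match_scalars <;> field_simp; ring)
    (fun v => by
      simp only [add_apply, sub_apply, ContinuousLinearMap.id_apply,
        ContinuousLinearMap.smulRight_apply, smul_apply, map_sub, map_smul, smul_eq_mul]
      match_scalars <;> field_simp; ring)

theorem strictMono_add_of_hasLineDerivAt {u : E → ℝ} {e : E}
    (h : ∀ p, ∃ d : ℝ, HasLineDerivAt ℝ u d p e ∧ 0 < 1 + d) (p : E) :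
    StrictMono fun r : ℝ => r + u (p + r • e) := by
  have key : ∀ r : ℝ, ∃ d : ℝ, HasDerivAt (fun r : ℝ => r + u (p + r • e)) d r ∧ 0 < d := by
    intro r
    obtain ⟨d, hd, hd0⟩ := h (p + r • e)
    refine ⟨1 + d, (hasDerivAt_id r).add ?_, hd0⟩
    have h1 : HasDerivAt (fun s : ℝ => s - r) 1 r := (hasDerivAt_id r).sub_const r
    have h2 : HasDerivAt (fun s : ℝ => u (p + r • e + s • e)) d (r - r) := by
      rw [sub_self]; exact hd
    have h3 := HasDerivAt.comp (h := fun s : ℝ => s - r) r h2 h1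
    rw [mul_one] at h3
    refine h3.congr_of_eventuallyEq (Filter.Eventually.of_forall fun s => ?_)
    simp only [Function.comp_apply]
    congr 1
    rw [sub_smul]; abel
  refine strictMono_of_deriv_pos fun r => ?_
  obtain ⟨d, hd, hd0⟩ := key r
  rw [hd.deriv]; exact hd0

/-- A bounded shear `p ↦ p + u p • e` which is increasing along the lines of direction `e` is a
diffeomorphism: it is bijective on each such line, and its differential is invertible. -/
theorem exists_diffeomorph_shear [CompleteSpace E] {u : E → ℝ} (hu : ContDiff ℝ ∞ u) {e : E}
    {C : ℝ} (hC : ∀ p, |u p| ≤ C)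
    (h : ∀ p, ∃ d : ℝ, HasLineDerivAt ℝ u d p e ∧ 0 < 1 + d) :
    ∃ Φ : E ≃ₘ[ℝ] E, ∀ p, Φ p = p + u p • e := by
  have hsm : ContDiff ℝ ∞ fun p => p + u p • e := contDiff_id.add (hu.smul contDiff_const)
  have hne : ∀ p, 1 + fderiv ℝ u p e ≠ 0 := by
    intro p
    obtain ⟨d, hd, hd0⟩ := h p
    have := ((hu.differentiable (by simp)) p).hasFDerivAt.hasLineDerivAt e
    rw [hd.unique this] at hd0
    exact hd0.ne'
  have hder : ∀ p, HasStrictFDerivAt (fun p => p + u p • e)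
      (shearEquiv (fderiv ℝ u p) e (hne p) : E →L[ℝ] E) p := by
    intro p
    have h1 : HasStrictFDerivAt u (fderiv ℝ u p) p :=
      hu.contDiffAt.hasStrictFDerivAt (by simp)
    exact (hasStrictFDerivAt_id p).add (h1.smul_const e)
  have hinj : Function.Injective fun p => p + u p • e := by
    intro p q hpq
    simp only at hpq
    have hq : q = p + (u p - u q) • e := by
      rw [sub_smul, add_sub, hpq, add_sub_cancel_right]
    have hm := (strictMono_add_of_hasLineDerivAt h p).injective
    have : (u p - u q) = 0 := by
      apply hm
      simp only [← hq]
      simp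
    rw [hq, this]; simp
  have hsurj : Function.Surjective fun p => p + u p • e := by
    intro y
    have hcont : Continuous fun r : ℝ => r + u (y + r • e) :=
      continuous_id.add (hu.continuous.comp (by fun_prop))
    have hbot : (-C) + u (y + (-C) • e) ≤ 0 := by
      have := (abs_le.1 (hC (y + (-C) • e))).2; linarith
    have htop : 0 ≤ C + u (y + C • e) := by
      have := (abs_le.1 (hC (y + C • e))).1; linarith
    obtain ⟨r, hr⟩ := mem_range_of_exists_le_of_exists_ge hcont ⟨_, hbot⟩ ⟨_, htop⟩
    refine ⟨y + r • e, ?_⟩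
    simp only at hr ⊢
    rw [add_assoc, ← add_smul, hr, zero_smul, add_zero]
  let φ : E ≃ₜ E := (Equiv.ofBijective _ ⟨hinj, hsurj⟩).toHomeomorphOfContinuousOpen
    hsm.continuous (isOpenMap_of_hasStrictFDerivAt_equiv hder)
  exact ⟨⟨φ.toEquiv, hsm.contMDiff,
    (φ.contDiff_symm (fun p => (hder p).hasFDerivAt) hsm).contMDiff⟩, fun _ => rfl⟩

end Shear

/-! ### Coordinates -/

/-- The coordinate vector `∂/∂xᵢ`. It is tangent to the contact structure at every point. -/
def dirX (n : ℕ) (i : Fin n) : Space n := (Pi.single i 1, 0, 0)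

/-- The coordinate vector `∂/∂z`. -/
def dirZ (n : ℕ) : Space n := (0, 0, 1)

theorem norm_dirX_le (n : ℕ) (i : Fin n) : ‖dirX n i‖ ≤ 1 := by
  simp [dirX, Prod.norm_def, Pi.norm_single]

theorem norm_dirZ_le (n : ℕ) : ‖dirZ n‖ ≤ 1 := by
  simp [dirZ, Prod.norm_def]

@[simp] theorem dirX_fst_self (n : ℕ) (i : Fin n) : (dirX n i).1 i = 1 := by simp [dirX]

@[simp] theorem dirX_snd (n : ℕ) (i : Fin n) : (dirX n i).2 = 0 := rfl

@[simp] theorem dirZ_fst (n : ℕ) : (dirZ n).1 = 0 := rfl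

@[simp] theorem dirZ_snd_fst (n : ℕ) : (dirZ n).2.1 = 0 := rfl

@[simp] theorem dirZ_snd_snd (n : ℕ) : (dirZ n).2.2 = 1 := rfl

@[simp] theorem form_dirZ (n : ℕ) (p : Space n) : form n p (dirZ n) = 1 := by
  simp [form_apply]

theorem abs_coord_le {n : ℕ} (i : Fin n) (p : Space n) : |p.1 i| ≤ ‖p‖ :=
  (norm_le_pi_norm p.1 i).trans (norm_fst_le p)

theorem norm_smul_dirX_le {n : ℕ} (i : Fin n) (r : ℝ) : ‖r • dirX n i‖ ≤ |r| := by
  rw [norm_smul, Real.norm_eq_abs]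
  exact mul_le_of_le_one_right (abs_nonneg r) (norm_dirX_le n i)

theorem norm_smul_dirZ_le {n : ℕ} (r : ℝ) : ‖r • dirZ n‖ ≤ |r| := by
  rw [norm_smul, Real.norm_eq_abs]
  exact mul_le_of_le_one_right (abs_nonneg r) (norm_dirZ_le n)

/-! ### The sliding squeeze in the direction of `x` -/

/-- An even cutoff of the line, equal to `1` on `[-R, R]` and to `0` where `x² ≥ 2R²`. -/
noncomputable def cutoff (R x : ℝ) : ℝ := Real.smoothTransition (2 - x ^ 2 / R ^ 2)

theorem contDiff_cutoff (R : ℝ) : ContDiff ℝ ∞ (cutoff R) :=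
  Real.smoothTransition.contDiff.comp (by fun_prop)

theorem cutoff_nonneg (R x : ℝ) : 0 ≤ cutoff R x := Real.smoothTransition.nonneg _

theorem cutoff_le_one (R x : ℝ) : cutoff R x ≤ 1 := Real.smoothTransition.le_one _

theorem cutoff_eq_one {R x : ℝ} (hR : 0 < R) (hx : |x| ≤ R) : cutoff R x = 1 := by
  apply Real.smoothTransition.one_of_one_le
  have : x ^ 2 / R ^ 2 ≤ 1 := by
    rw [div_le_one (by positivity)]; exact sq_le_sq' (abs_le.1 hx).1 (abs_le.1 hx).2
  linarith

theorem abs_lt_of_cutoff_ne_zero {R x : ℝ} (hR : 0 < R) (hx : cutoff R x ≠ 0) :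
    |x| < 2 * R := by
  by_contra! h
  apply hx
  apply Real.smoothTransition.zero_of_nonpos
  have h2 : (2 * R) ^ 2 ≤ x ^ 2 := by
    rw [← sq_abs x]; exact pow_le_pow_left₀ (by positivity) h 2
  have : 2 ≤ x ^ 2 / R ^ 2 := by
    rw [le_div_iff₀ (by positivity)]; nlinarith [sq_nonneg R]
  linarith

/-- The cutoff decreases away from `[-R, R]`, so moving towards a point of `[-R, R]` with speed
proportional to the cutoff squeezes this interval without creating critical points. -/
theorem deriv_cutoff_mul_nonneg {R x y : ℝ} (hR : 0 < R) (hy : |y| ≤ R) :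
    0 ≤ deriv (cutoff R) x * (y - x) := by
  rcases lt_or_ge |x| R with hx | hx
  · have : cutoff R =ᶠ[nhds x] fun _ => 1 := by
      filter_upwards [(isOpen_lt continuous_abs continuous_const).mem_nhds hx] with z hz
      exact cutoff_eq_one hR (le_of_lt hz)
    rw [this.deriv_eq]; simp
  · have h1 : HasDerivAt (fun z : ℝ => 2 - z ^ 2 / R ^ 2) (-(2 * x / R ^ 2)) x := by
      simpa using ((hasDerivAt_pow 2 x).div_const (R ^ 2)).const_sub 2
    have h2 : HasDerivAt (cutoff R)
        (deriv Real.smoothTransition (2 - x ^ 2 / R ^ 2) * (-(2 * x / R ^ 2))) x :=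
      HasDerivAt.comp (h := fun z : ℝ => 2 - z ^ 2 / R ^ 2) x
        ((Real.smoothTransition.contDiff (n := 1)).differentiable (by simp) _).hasDerivAt h1
    rw [h2.deriv]
    have h3 : 0 ≤ deriv Real.smoothTransition (2 - x ^ 2 / R ^ 2) :=
      Real.smoothTransition.monotone.deriv_nonneg
    have h4 : 0 ≤ x * (x - y) := by
      have : x * y ≤ |x| * |x| :=
        (le_abs_self _).trans (by
          rw [abs_mul]; exact mul_le_mul_of_nonneg_left (hy.trans hx) (abs_nonneg x))
      rw [abs_mul_abs_self] at this; nlinarith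
    have : deriv Real.smoothTransition (2 - x ^ 2 / R ^ 2) * (-(2 * x / R ^ 2)) * (y - x)
        = deriv Real.smoothTransition (2 - x ^ 2 / R ^ 2) * (2 * (x * (x - y)) / R ^ 2) := by
      ring
    rw [this]
    positivity

/-- The time profile of the squeeze: `0` outside `(0, 1)` and `1` on `[1 / N, 1 - 1 / N]`. -/
noncomputable def timeProfile (N t : ℝ) : ℝ :=
  Real.smoothTransition (N * t) * Real.smoothTransition (N * (1 - t))

theorem contDiff_timeProfile (N : ℝ) : ContDiff ℝ ∞ (timeProfile N) :=
  (Real.smoothTransition.contDiff.comp (by fun_prop)).mul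
    (Real.smoothTransition.contDiff.comp (by fun_prop))

theorem timeProfile_nonneg (N t : ℝ) : 0 ≤ timeProfile N t :=
  mul_nonneg (Real.smoothTransition.nonneg _) (Real.smoothTransition.nonneg _)

theorem timeProfile_le_one (N t : ℝ) : timeProfile N t ≤ 1 :=
  mul_le_one₀ (Real.smoothTransition.le_one _) (Real.smoothTransition.nonneg _)
    (Real.smoothTransition.le_one _)

theorem mem_Ioo_of_timeProfile_ne_zero {N t : ℝ} (hN : 0 < N) (h : timeProfile N t ≠ 0) :
    t ∈ Ioo (0 : ℝ) 1 := by
  constructor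
  · by_contra! ht
    exact h (by rw [timeProfile, Real.smoothTransition.zero_of_nonpos (by nlinarith), zero_mul])
  · by_contra! ht
    exact h (by
      rw [timeProfile, Real.smoothTransition.zero_of_nonpos (x := N * (1 - t)) (by nlinarith),
        mul_zero])

theorem timeProfile_eq_one {N t : ℝ} (hN : 0 < N) (h0 : 1 / N ≤ t) (h1 : t ≤ 1 - 1 / N) :
    timeProfile N t = 1 := by
  rw [timeProfile, Real.smoothTransition.one_of_one_le, Real.smoothTransition.one_of_one_le,
    one_mul]
  · have : 1 / N ≤ 1 - t := by linarith
    rw [div_le_iff₀ hN] at this; linarith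
  · rw [div_le_iff₀ hN] at h0; linarith

/-- A time-dependent displacement in the direction `∂/∂xᵢ`. During `[1 / N, 1 - 1 / N]` the
resulting map squeezes the `xᵢ`-coordinate of the ball of radius `R` into an interval of radius
`1 / N`, which slides from the left to the right. -/
theorem exists_squeeze {n : ℕ} (i : Fin n) {R N : ℝ} (hR : 1 ≤ R) (hN : 2 ≤ N) :
    ∃ u : ℝ × Space n → ℝ, ContDiff ℝ ∞ u ∧ (∀ x, |u x| ≤ 3 * R) ∧
      (∀ x, ∃ d : ℝ, HasLineDerivAt ℝ u d x (0, dirX n i) ∧ 0 < 1 + d) ∧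
      (∀ p, u (0, p) = 0) ∧ (∀ p, u (1, p) = 0) ∧
      (∀ t p, 4 * R + 1 ≤ ‖p‖ → u (t, p) = 0) ∧
      (∀ t p, ‖p‖ ≤ R → 1 / N ≤ t → t ≤ 1 - 1 / N →
        |p.1 i + u (t, p) - (R - 1 / N) * (2 * t - 1)| ≤ 1 / N) := by
  have hR0 : 0 < R := by linarith
  have hN0 : 0 < N := by linarith
  let π : Space n → Space n := fun p => p - p.1 i • dirX n i
  -- the cutoff in the other coordinates must not depend on `xᵢ`, hence the projection `π`;
  -- its norm is at most `2`, hence the inner radius `2 R`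
  let B : ContDiffBump (0 : Space n) := ⟨2 * R, 2 * R + 1, by linarith, by linarith⟩
  -- the contraction factor is `1 - l = 1 / (N R)`
  let l : ℝ := 1 - 1 / (N * R)
  have hNR : 1 < N * R := by nlinarith
  have hl1 : l < 1 := by
    have : 0 < 1 / (N * R) := by positivity
    simp only [l]; linarith
  have hl0 : 0 < l := by
    have : 1 / (N * R) < 1 := by rw [div_lt_one (by linarith)]; exact hNR
    simp only [l]; linarith
  let u : ℝ × Space n → ℝ := fun x =>
    timeProfile N x.1 * (cutoff R (x.2.1 i) * B (π x.2)) * (l * (R * (2 * x.1 - 1) - x.2.1 i))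
  have hcoord : ContDiff ℝ ∞ fun x : ℝ × Space n => x.2.1 i := by fun_prop
  have hπ : ContDiff ℝ ∞ fun x : ℝ × Space n => π x.2 := by
    have : ContDiff ℝ ∞ fun x : ℝ × Space n => x.2.1 i • dirX n i := hcoord.smul contDiff_const
    exact contDiff_snd.sub this
  have hu : ContDiff ℝ ∞ u :=
    (((contDiff_timeProfile N).comp contDiff_fst).mul
      (((contDiff_cutoff R).comp hcoord).mul (B.contDiff.comp hπ))).mul
      (contDiff_const.mul ((by fun_prop : ContDiff ℝ ∞ fun x : ℝ × Space n =>
        R * (2 * x.1 - 1)).sub hcoord))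
  refine ⟨u, hu, ?_, ?_, ?_, ?_, ?_, ?_⟩
  · intro x
    by_cases h0 : u x = 0
    · rw [h0, abs_zero]; linarith
    have ht : timeProfile N x.1 ≠ 0 := fun h => h0 (by simp [u, h])
    have hc : cutoff R (x.2.1 i) ≠ 0 := fun h => h0 (by simp [u, h])
    obtain ⟨ht0, ht1⟩ := mem_Ioo_of_timeProfile_ne_zero hN0 ht
    have hx := abs_lt.1 (abs_lt_of_cutoff_ne_zero hR0 hc)
    have h1 : |R * (2 * x.1 - 1) - x.2.1 i| ≤ 3 * R := by
      rw [abs_le]; constructor <;> nlinarith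
    have h2 : |timeProfile N x.1 * (cutoff R (x.2.1 i) * B (π x.2))| ≤ 1 := by
      rw [abs_of_nonneg (mul_nonneg (timeProfile_nonneg _ _)
        (mul_nonneg (cutoff_nonneg _ _) B.nonneg))]
      exact mul_le_one₀ (timeProfile_le_one _ _) (mul_nonneg (cutoff_nonneg _ _) B.nonneg)
        (mul_le_one₀ (cutoff_le_one _ _) B.nonneg B.le_one)
    calc |u x| = |timeProfile N x.1 * (cutoff R (x.2.1 i) * B (π x.2))|
          * (l * |R * (2 * x.1 - 1) - x.2.1 i|) := by
            simp only [u]; rw [abs_mul, abs_mul l, abs_of_pos hl0]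
      _ ≤ 1 * (1 * (3 * R)) := by gcongr
      _ = 3 * R := by ring
  · rintro ⟨t, p⟩
    have hline : (fun r : ℝ => u ((t, p) + r • (0, dirX n i))) = fun r : ℝ =>
        timeProfile N t * (cutoff R (p.1 i + r) * B (π p)) *
          (l * (R * (2 * t - 1) - (p.1 i + r))) := by
      funext r
      have h1 : (p + r • dirX n i).1 i = p.1 i + r := by simp
      have h2 : π (p + r • dirX n i) = π p := by
        simp only [π]; rw [h1, add_smul]; abel
      have h3 : (t, p) + r • ((0 : ℝ), dirX n i) = (t, p + r • dirX n i) := by simp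
      simp only [u]; rw [h3]; simp only [h1, h2]
    have hcd : HasDerivAt (fun r : ℝ => cutoff R (p.1 i + r)) (deriv (cutoff R) (p.1 i)) 0 := by
      have := ((contDiff_cutoff R).differentiable (by simp) (p.1 i + 0)).hasDerivAt
      simpa using HasDerivAt.comp_const_add (p.1 i) 0 this
    have hld : HasDerivAt (fun r : ℝ => l * (R * (2 * t - 1) - (p.1 i + r))) (-l) 0 := by
      have := (((hasDerivAt_id (0 : ℝ)).const_add (p.1 i)).const_sub (R * (2 * t - 1))).const_mul l
      simpa using this
    have hd := ((hcd.mul_const (B (π p))).const_mul (timeProfile N t)).mul hld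
    rw [Pi.mul_def, ← hline] at hd
    refine ⟨_, hd, ?_⟩
    · simp only [add_zero]
      set s := timeProfile N t with hs
      set b := B (π p)
      have hs0 : 0 ≤ s := timeProfile_nonneg N t
      have hs1 : s ≤ 1 := timeProfile_le_one N t
      have hb0 : 0 ≤ b := B.nonneg
      have hb1 : b ≤ 1 := B.le_one
      have h1 : 0 ≤ s * (b * l * (deriv (cutoff R) (p.1 i) * (R * (2 * t - 1) - p.1 i))) := by
        by_cases h0 : s = 0
        · rw [h0, zero_mul]
        obtain ⟨ht0, ht1⟩ := mem_Ioo_of_timeProfile_ne_zero hN0 (hs ▸ h0)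
        have : |R * (2 * t - 1)| ≤ R := by rw [abs_le]; constructor <;> nlinarith
        have := deriv_cutoff_mul_nonneg (x := p.1 i) hR0 this
        positivity
      have h2 : s * (cutoff R (p.1 i) * b) * l ≤ l :=
        mul_le_of_le_one_left hl0.le (mul_le_one₀ hs1 (mul_nonneg (cutoff_nonneg _ _) hb0)
          (mul_le_one₀ (cutoff_le_one _ _) hb0 hb1))
      nlinarith
  · intro p
    simp [u, timeProfile, Real.smoothTransition.zero]
  · intro p
    simp [u, timeProfile, Real.smoothTransition.zero]
  · intro t p hp
    by_contra h0
    have hc : cutoff R (p.1 i) ≠ 0 := fun h => h0 (by simp [u, h])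
    have hb : B (π p) ≠ 0 := fun h => h0 (by simp [u, h])
    have hx := abs_lt_of_cutoff_ne_zero hR0 hc
    have hπp : ‖π p‖ < 2 * R + 1 := by
      by_contra! h
      exact hb (B.zero_of_le_dist (by rw [dist_zero_right]; exact h))
    have : ‖p‖ ≤ ‖π p‖ + |p.1 i| := by
      calc ‖p‖ = ‖π p + p.1 i • dirX n i‖ := by simp [π]
        _ ≤ _ := (norm_add_le _ _).trans (by gcongr; exact norm_smul_dirX_le _ _)
    linarith
  · intro t p hp ht0 ht1
    have hx := (abs_coord_le i p).trans hp
    have hπp : ‖π p‖ ≤ 2 * R :=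
      (norm_sub_le _ _).trans (by linarith [norm_smul_dirX_le i (p.1 i)])
    have hb : B (π p) = 1 :=
      B.one_of_mem_closedBall (by rw [mem_closedBall_zero_iff]; exact hπp)
    have huv : u (t, p) = l * (R * (2 * t - 1) - p.1 i) := by
      simp only [u]
      rw [timeProfile_eq_one hN0 ht0 ht1, cutoff_eq_one hR0 hx, hb]; ring
    have hlR : l * R = R - 1 / N := by simp only [l]; field_simp
    have : p.1 i + u (t, p) - (R - 1 / N) * (2 * t - 1) = p.1 i / (N * R) := by
      rw [huv, ← hlR]; simp only [l]; ring
    rw [this, abs_div, abs_of_pos (by linarith : (0 : ℝ) < N * R),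
      div_le_div_iff₀ (by linarith) hN0]
    nlinarith

/-! ### The vertical displacement -/

/-- An increasing function of `t`, of total variation at most `3π`, whose derivative is of order
`N` for `t` within `1 / N` of `0`, of `1`, or of the time when `m (2t - 1) = x`. -/
noncomputable def rise (N m x t : ℝ) : ℝ :=
  Real.arctan (N * t) + Real.arctan (N * (t - 1)) + Real.arctan (N * (m * (2 * t - 1) - x))

theorem abs_rise_sub_le (N m x s t : ℝ) : |rise N m x s - rise N m x t| ≤ 12 := by
  have key : ∀ a b : ℝ, |Real.arctan a - Real.arctan b| ≤ 4 := by
    intro a b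
    have := Real.pi_le_four
    rw [abs_le]
    constructor <;>
      linarith [Real.arctan_lt_pi_div_two a, Real.neg_pi_div_two_lt_arctan a,
        Real.arctan_lt_pi_div_two b, Real.neg_pi_div_two_lt_arctan b]
  have h1 := abs_le.1 (key (N * s) (N * t))
  have h2 := abs_le.1 (key (N * (s - 1)) (N * (t - 1)))
  have h3 := abs_le.1 (key (N * (m * (2 * s - 1) - x)) (N * (m * (2 * t - 1) - x)))
  simp only [rise]
  rw [abs_le]
  constructor <;> linarith

theorem exists_hasDerivAt_rise {N m : ℝ} (hN : 0 < N) (hm : 1 / 2 ≤ m) (x t : ℝ) :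
    ∃ d, HasDerivAt (rise N m x) d t ∧ 0 ≤ d ∧
      (|t| ≤ 1 / N ∨ |t - 1| ≤ 1 / N ∨ |x - m * (2 * t - 1)| ≤ 1 / N → N / 2 ≤ d) := by
  have h1 : HasDerivAt (fun t : ℝ => N * t) N t := by
    simpa using (hasDerivAt_id t).const_mul N
  have h2 : HasDerivAt (fun t : ℝ => N * (t - 1)) N t := by
    simpa using ((hasDerivAt_id t).sub_const 1).const_mul N
  have h3 : HasDerivAt (fun t : ℝ => N * (m * (2 * t - 1) - x)) (N * (m * 2)) t := by
    simpa using
      ((((((hasDerivAt_id t).const_mul 2).sub_const 1).const_mul m).sub_const x).const_mul N)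
  have key : ∀ a : ℝ, |a| ≤ 1 / N → 1 / 2 ≤ 1 / (1 + (N * a) ^ 2) := by
    intro a ha
    have hNa : |N * a| ≤ 1 := by
      rw [abs_mul, abs_of_pos hN]
      rw [le_div_iff₀ hN] at ha; linarith
    have : (N * a) ^ 2 ≤ 1 := (sq_le_one_iff_abs_le_one _).2 hNa
    apply one_div_le_one_div_of_le (by positivity); linarith
  have p1 : 0 ≤ 1 / (1 + (N * t) ^ 2) * N := by positivity
  have p2 : 0 ≤ 1 / (1 + (N * (t - 1)) ^ 2) * N := by positivity
  have p3 : 0 ≤ 1 / (1 + (N * (m * (2 * t - 1) - x)) ^ 2) * (N * (m * 2)) := by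
    have : 0 ≤ m := by linarith
    positivity
  refine ⟨_, (h1.arctan.add h2.arctan).add h3.arctan, by linarith, ?_⟩
  rintro (h | h | h)
  · nlinarith [key _ h]
  · nlinarith [key _ h]
  · rw [abs_sub_comm] at h
    have h4 := key _ h
    have h5 : N ≤ N * (m * 2) := by nlinarith
    have h6 : 1 / 2 * N ≤ 1 / (1 + (N * (m * (2 * t - 1) - x)) ^ 2) * (N * (m * 2)) := by
      gcongr
    linarith

/-- A loop of vertical displacements which sinks slowly everywhere but rises at a speed of order
`ε N` where `xᵢ` is within `1 / N` of a point sliding from the left to the right, and everywhere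
near the times `0` and `1`. -/
theorem exists_lift {n : ℕ} (i : Fin n) {R : ℝ} (hR : 1 ≤ R) :
    ∃ ε₀ : ℝ, 0 < ε₀ ∧ ∀ ε : ℝ, 0 < ε → ε ≤ ε₀ → ∀ N : ℝ, 2 ≤ N →
      ∃ D : ℝ × Space n → ℝ, ContDiff ℝ ∞ D ∧
        (∀ q, D (0, q) = 0) ∧ (∀ q, D (1, q) = 0) ∧
        (∀ t ∈ Icc (0 : ℝ) 1, ∀ q, |D (t, q)| ≤ 1) ∧
        (∀ t ∈ Icc (0 : ℝ) 1, ∀ q, ∃ d : ℝ,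
          HasLineDerivAt ℝ (fun q => D (t, q)) d q (dirZ n) ∧ |d| < 1) ∧
        (∀ t q, 4 * R + 2 ≤ ‖q‖ → D (t, q) = 0) ∧
        ∀ t ∈ Icc (0 : ℝ) 1, ∀ q, ∃ d : ℝ, HasDerivAt (fun s => D (s, q)) d t ∧
          -(12 * ε) ≤ d ∧
          (‖q‖ ≤ 4 * R + 1 → (t ≤ 1 / N ∨ 1 - 1 / N ≤ t ∨
            |q.1 i - (R - 1 / N) * (2 * t - 1)| ≤ 1 / N) → ε * (N / 2) - 12 * ε ≤ d) := by
  -- the cutoff is `1` on all points that the squeeze and a lift by at most `1` bring into the ball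
  -- of radius `R`
  let B : ContDiffBump (0 : Space n) := ⟨4 * R + 1, 4 * R + 2, by linarith, by linarith⟩
  have hBd : Differentiable ℝ B := (B.contDiff (n := 1)).differentiable (by simp)
  obtain ⟨c, hc⟩ : ∃ c, ∀ q, ‖fderiv ℝ B q (dirZ n)‖ ≤ c := by
    have hcont : Continuous fun q => fderiv ℝ B q (dirZ n) :=
      ((B.contDiff (n := 1)).continuous_fderiv (by simp)).clm_apply continuous_const
    have hsupp : HasCompactSupport fun q => fderiv ℝ B q (dirZ n) :=
      (B.hasCompactSupport.fderiv (𝕜 := ℝ)).comp_left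
        (g := fun l : Space n →L[ℝ] ℝ => l (dirZ n)) (by simp)
    exact hcont.bounded_above_of_compact_support hsupp
  have hc0 : 0 ≤ c := (norm_nonneg _).trans (hc 0)
  -- `|D| ≤ 24 ε` before the cutoff, so this makes both `|D|` and its slope `∂D/∂z` smaller than `1`
  refine ⟨1 / (24 * (c + 1)) / 2, by positivity, fun ε hε hε1 N hN => ?_⟩
  have hε2 : 24 * ε * (c + 1) < 1 := by
    have : 0 < 24 * (c + 1) := by positivity
    rw [div_div, le_div_iff₀ (by positivity)] at hε1
    nlinarith
  have hN0 : 0 < N := by linarith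
  have hN1 : 1 / N ≤ 1 / 2 := one_div_le_one_div_of_le (by norm_num) hN
  have hm : 1 / 2 ≤ R - 1 / N := by linarith
  set m := R - 1 / N
  -- subtracting the linear interpolation of the endpoint values closes the loop
  let A : ℝ → ℝ → ℝ := fun t x =>
    rise N m x t - rise N m x 0 - t * (rise N m x 1 - rise N m x 0)
  let D : ℝ × Space n → ℝ := fun y => B y.2 * (ε * A y.1 (y.2.1 i))
  have hA : ∀ t ∈ Icc (0 : ℝ) 1, ∀ x, |A t x| ≤ 24 := by
    intro t ht x
    have h1 := abs_rise_sub_le N m x t 0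
    have h2 := abs_rise_sub_le N m x 1 0
    have h3 : |t * (rise N m x 1 - rise N m x 0)| ≤ 1 * 12 := by
      rw [abs_mul, abs_of_nonneg ht.1]
      exact mul_le_mul ht.2 h2 (abs_nonneg _) zero_le_one
    calc |A t x| ≤ _ := abs_sub _ _
      _ ≤ 24 := by linarith
  have hrise : ∀ g : ℝ × Space n → ℝ, ContDiff ℝ ∞ g →
      ContDiff ℝ ∞ fun y : ℝ × Space n => rise N m (y.2.1 i) (g y) := by
    intro g hg
    have hcoord : ContDiff ℝ ∞ fun x : ℝ × Space n => x.2.1 i := by fun_prop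
    exact ((ContDiff.arctan (by fun_prop)).add (ContDiff.arctan (by fun_prop))).add
      (ContDiff.arctan (by fun_prop))
  have hD : ContDiff ℝ ∞ D := by
    have h1 := hrise _ contDiff_fst
    have h2 := hrise _ (contDiff_const (c := (0 : ℝ)))
    have h3 := hrise _ (contDiff_const (c := (1 : ℝ)))
    exact (B.contDiff.comp contDiff_snd).mul
      (contDiff_const.mul ((h1.sub h2).sub (contDiff_fst.mul (h3.sub h2))))
  refine ⟨D, hD, fun q => by simp [D, A], fun q => by simp [D, A], ?_, ?_, ?_, ?_⟩
  · intro t ht q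
    have h1 : |B q| ≤ 1 := by rw [abs_of_nonneg B.nonneg]; exact B.le_one
    have h2 := hA t ht (q.1 i)
    calc |D (t, q)| = |B q| * (ε * |A t (q.1 i)|) := by
          simp only [D]; rw [abs_mul, abs_mul, abs_of_pos hε]
      _ ≤ 1 * (ε * 24) := by gcongr
      _ ≤ 1 := by nlinarith
  · intro t ht q
    have h1 : HasLineDerivAt ℝ B (fderiv ℝ B q (dirZ n)) q (dirZ n) :=
      (hBd q).hasFDerivAt.hasLineDerivAt _
    refine ⟨fderiv ℝ B q (dirZ n) * (ε * A t (q.1 i)), ?_, ?_⟩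
    · have h2 : HasDerivAt (fun r : ℝ => B (q + r • dirZ n) * (ε * A t (q.1 i)))
        (fderiv ℝ B q (dirZ n) * (ε * A t (q.1 i))) 0 := HasDerivAt.mul_const h1 _
      have h3 : (fun r : ℝ => D (t, q + r • dirZ n)) =
          fun r : ℝ => B (q + r • dirZ n) * (ε * A t (q.1 i)) := by
        funext r; simp [D]
      rw [← h3] at h2
      exact h2
    · have h2 := hA t ht (q.1 i)
      have h3 := hc q
      rw [Real.norm_eq_abs] at h3
      calc |fderiv ℝ B q (dirZ n) * (ε * A t (q.1 i))|
          = |fderiv ℝ B q (dirZ n)| * (ε * |A t (q.1 i)|) := by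
            rw [abs_mul, abs_mul, abs_of_pos hε]
        _ ≤ c * (ε * 24) := by gcongr
        _ < 1 := by nlinarith
  · intro t q hq
    have : B q = 0 := B.zero_of_le_dist (by rw [dist_zero_right]; exact hq)
    simp [D, this]
  · intro t ht q
    obtain ⟨d, hd, hd0, hd1⟩ := exists_hasDerivAt_rise hN0 hm (q.1 i) t
    set r := rise N m (q.1 i) 1 - rise N m (q.1 i) 0
    have hr : r ≤ 12 := (le_abs_self _).trans (abs_rise_sub_le _ _ _ _ _)
    have hder : HasDerivAt (fun s => D (s, q)) (B q * (ε * (d - r))) t := by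
      have h1 : HasDerivAt (fun s => A s (q.1 i)) (d - r) t := by
        have := (hd.sub_const (rise N m (q.1 i) 0)).fun_sub ((hasDerivAt_id t).mul_const r)
        rw [one_mul] at this
        exact this
      exact (h1.const_mul ε).const_mul (B q)
    refine ⟨_, hder, ?_, ?_⟩
    · have hB0 : 0 ≤ B q := B.nonneg
      have hB1 : B q ≤ 1 := B.le_one
      have h1 : ε * (-12) ≤ ε * (d - r) := by gcongr; linarith
      have h2 : B q * (ε * (-12)) ≤ B q * (ε * (d - r)) := by gcongr
      nlinarith
    · intro hq hor
      have hB : B q = 1 := B.one_of_mem_closedBall (by rw [mem_closedBall_zero_iff]; exact hq)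
      have hd2 : N / 2 ≤ d := by
        apply hd1
        rcases hor with h | h | h
        · left; rw [abs_of_nonneg ht.1]; exact h
        · right; left; rw [abs_le]; constructor <;> linarith [ht.2]
        · right; right; exact h
      have h1 : ε * (N / 2 - 12) ≤ ε * (d - r) := by gcongr
      rw [hB]; linarith

/-! ### Loops that rise quickly in a ball and sink slowly elsewhere -/

/-- For every ball there is a region of fixed size which supports loops of diffeomorphisms that
move up as fast as desired wherever they pass through the ball, and sink as slowly as desired
elsewhere; `σ = -1` exchanges up and down. -/
theorem exists_loop {n : ℕ} (i : Fin n) {R : ℝ} (hR : 1 ≤ R) {σ : ℝ} (hσ : |σ| = 1)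
    {δ : ℝ} (hδ : 0 < δ) (C : ℝ) :
    ∃ H : ℝ × Space n → Space n, ContDiff ℝ ∞ H ∧
      (∀ t ∈ Icc (0 : ℝ) 1, ∃ Ψ : Diff n, ∀ q, Ψ q = H (t, q)) ∧
      (∀ q, H (0, q) = q) ∧ (∀ q, H (1, q) = q) ∧
      (∀ t q, 4 * R + 2 ≤ ‖q‖ → H (t, q) = q) ∧
      ∀ t ∈ Icc (0 : ℝ) 1, ∀ q, ∃ (v : Space n) (w : ℝ), HasDerivAt (fun s => H (s, q)) v t ∧
        form n (H (t, q)) v = σ * w ∧ -δ ≤ w ∧ (‖H (t, q)‖ ≤ R → C ≤ w) := by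
  obtain ⟨ε₀, hε₀, hlift⟩ := exists_lift i hR
  obtain ⟨ε, hε, hε1, hε2⟩ : ∃ ε : ℝ, 0 < ε ∧ ε ≤ ε₀ ∧ 12 * ε ≤ δ :=
    ⟨min ε₀ (δ / 12), by positivity, min_le_left _ _, by
      have := min_le_right ε₀ (δ / 12); linarith⟩
  obtain ⟨N, hN, hNC⟩ : ∃ N : ℝ, 2 ≤ N ∧ C ≤ ε * (N / 2) - 12 * ε := by
    refine ⟨max 2 (2 * (C + 12 * ε) / ε), le_max_left _ _, ?_⟩
    have := le_max_right 2 (2 * (C + 12 * ε) / ε)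
    rw [div_le_iff₀ hε] at this
    linarith
  obtain ⟨D, hD, hD0, hD1, hDb, hDz, hDs, hDt⟩ := hlift ε hε hε1 N hN
  obtain ⟨u, hu, hub, hux, hu0, hu1, hus, huR⟩ := exists_squeeze i hR hN
  obtain ⟨Φ, hΦ⟩ := exists_diffeomorph_shear hu hub hux
  let Q : ℝ × Space n → Space n := fun y => y.2 + (σ * D y) • dirZ n
  have hQ : ContDiff ℝ ∞ Q := contDiff_snd.add ((contDiff_const.mul hD).smul contDiff_const)
  let H : ℝ × Space n → Space n := fun y => (Φ.symm (y.1, Q y)).2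
  have hH : ContDiff ℝ ∞ H :=
    contDiff_snd.comp (Φ.symm.contDiff.comp (contDiff_fst.prodMk hQ))
  -- `H` is characterised by the equation `Φ (t, H (t, q)) = (t, Q (t, q))`
  have heq : ∀ t q, H (t, q) + u (t, H (t, q)) • dirX n i = q + (σ * D (t, q)) • dirZ n := by
    intro t q
    have h1 := Φ.apply_symm_apply (t, Q (t, q))
    rw [hΦ] at h1
    have h2 : (Φ.symm (t, Q (t, q))).1 = t := by simpa using congrArg Prod.fst h1
    have h3 : Φ.symm (t, Q (t, q)) = (t, H (t, q)) := Prod.ext h2 rfl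
    rw [h3] at h1
    simpa [Q] using congrArg Prod.snd h1
  have huniq : ∀ t p q, p + u (t, p) • dirX n i = q + (σ * D (t, q)) • dirZ n →
      p = H (t, q) := by
    intro t p q h
    have h1 : Φ (t, p) = Φ (t, H (t, q)) := by
      rw [hΦ, hΦ]
      ext1
      · simp
      · simp [h, heq]
    exact congrArg Prod.snd (Φ.injective h1)
  refine ⟨H, hH, ?_, ?_, ?_, ?_, ?_⟩
  · intro t ht
    have hDt' : ContDiff ℝ ∞ fun q => σ * D (t, q) :=
      contDiff_const.mul (hD.comp (contDiff_const.prodMk contDiff_id))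
    obtain ⟨Ψ, hΨ⟩ := exists_diffeomorph_shear hDt' (C := 1) (e := dirZ n)
      (fun q => by rw [abs_mul, hσ, one_mul]; exact hDb t ht q)
      (fun q => by
        obtain ⟨d, hd, hd1⟩ := hDz t ht q
        refine ⟨σ * d, HasDerivAt.const_mul σ hd, ?_⟩
        have : |σ * d| < 1 := by rw [abs_mul, hσ, one_mul]; exact hd1
        linarith [(abs_lt.1 this).1])
    obtain ⟨P, hP⟩ := exists_diffeomorph_shear (u := fun p => u (t, p)) (e := dirX n i)
      (hu.comp (contDiff_const.prodMk contDiff_id)) (fun p => hub (t, p))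
      (fun p => by
        obtain ⟨d, hd, hd1⟩ := hux (t, p)
        refine ⟨d, ?_, hd1⟩
        unfold HasLineDerivAt at hd ⊢
        simpa using hd)
    refine ⟨Ψ.trans P.symm, fun q => huniq _ _ _ ?_⟩
    rw [← hΨ, ← hP]
    simp
  · intro q
    exact (huniq 0 q q (by rw [hu0, hD0]; simp)).symm
  · intro q
    exact (huniq 1 q q (by rw [hu1, hD1]; simp)).symm
  · intro t q hq
    exact (huniq t q q (by rw [hus t q (by linarith), hDs t q hq]; simp)).symm
  · intro t ht q
    have hv : HasDerivAt (fun s => H (s, q)) (deriv (fun s => H (s, q)) t) t :=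
      ((hH.comp (contDiff_id.prodMk contDiff_const)).differentiable (by simp) t).hasDerivAt
    set v := deriv (fun s => H (s, q)) t
    obtain ⟨w, hw, hw1, hw2⟩ := hDt t ht q
    -- the `y`-coordinates do not move, and the `z`-coordinate moves with `σ D`
    have hy : v.2.1 = 0 := by
      have h1 : HasDerivAt (fun s => (H (s, q)).2.1) v.2.1 t :=
        (((ContinuousLinearMap.fst ℝ (Fin n → ℝ) ℝ).comp
          (ContinuousLinearMap.snd ℝ (Fin n → ℝ) ((Fin n → ℝ) × ℝ))).hasFDerivAt).comp_hasDerivAt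
            t hv
      have h2 : (fun s => (H (s, q)).2.1) = fun _ => q.2.1 := by
        funext s
        simpa using congrArg (fun p : Space n => p.2.1) (heq s q)
      rw [h2] at h1
      exact h1.unique (hasDerivAt_const _ _)
    have hz : v.2.2 = σ * w := by
      have h1 : HasDerivAt (fun s => (H (s, q)).2.2) v.2.2 t :=
        (((ContinuousLinearMap.snd ℝ (Fin n → ℝ) ℝ).comp
          (ContinuousLinearMap.snd ℝ (Fin n → ℝ) ((Fin n → ℝ) × ℝ))).hasFDerivAt).comp_hasDerivAt
            t hv
      have h2 : (fun s => (H (s, q)).2.2) = fun s => q.2.2 + σ * D (s, q) := by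
        funext s
        simpa using congrArg (fun p : Space n => p.2.2) (heq s q)
      rw [h2] at h1
      exact h1.unique ((hw.const_mul σ).const_add _)
    refine ⟨v, w, hv, ?_, by linarith, fun hp => hNC.trans (hw2 ?_ ?_)⟩
    · rw [form_apply, hy, hz]; simp
    · have h1 : q = H (t, q) + u (t, H (t, q)) • dirX n i - (σ * D (t, q)) • dirZ n := by
        rw [heq, add_sub_cancel_right]
      have h2 : ‖(σ * D (t, q)) • dirZ n‖ ≤ 1 :=
        (norm_smul_dirZ_le _).trans (by rw [abs_mul, hσ, one_mul]; exact hDb t ht q)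
      have h3 : ‖u (t, H (t, q)) • dirX n i‖ ≤ 3 * R := (norm_smul_dirX_le _ _).trans (hub _)
      rw [h1]
      linarith [norm_sub_le (H (t, q) + u (t, H (t, q)) • dirX n i) ((σ * D (t, q)) • dirZ n),
        norm_add_le (H (t, q)) (u (t, H (t, q)) • dirX n i)]
    · rcases le_total t (1 / N) with h0 | h0
      · exact Or.inl h0
      rcases le_total (1 - 1 / N) t with h1 | h1
      · exact Or.inr (Or.inl h1)
      refine Or.inr (Or.inr ?_)
      have h2 := huR t (H (t, q)) hp h0 h1
      have h3 : (H (t, q)).1 i + u (t, H (t, q)) = q.1 i := by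
        simpa using congrArg (fun p : Space n => p.1 i) (heq t q)
      rwa [h3] at h2

/-! ### Paths of diffeomorphisms -/

/-- The evaluation map `(t, p) ↦ f t p` of a path of diffeomorphisms. -/
noncomputable def total {n : ℕ} (f : ℝ → Diff n) (y : ℝ × Space n) : Space n := f y.1 y.2

/-- The domain `[0, 1] × ℝ^{2n+1}` of the evaluation map of a path. -/
abbrev domain (n : ℕ) : Set (ℝ × Space n) := Icc (0 : ℝ) 1 ×ˢ univ

theorem uniqueDiffOn_domain (n : ℕ) : UniqueDiffOn ℝ (domain n) :=
  (uniqueDiffOn_Icc zero_lt_one).prod uniqueDiffOn_univ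

variable {n : ℕ} {f : ℝ → Diff n}

theorem IsSmoothPath.hasFDerivWithinAt (hf : IsSmoothPath f) {t : ℝ} (ht : t ∈ Icc (0 : ℝ) 1)
    (p : Space n) : HasFDerivWithinAt (total f) (fderivWithin ℝ (total f) (domain n) (t, p))
      (domain n) (t, p) :=
  ((hf.differentiableOn (by simp)) (t, p) ⟨ht, mem_univ p⟩).hasFDerivWithinAt

theorem IsSmoothPath.continuousOn_fderivWithin (hf : IsSmoothPath f) :
    ContinuousOn (fderivWithin ℝ (total f) (domain n)) (domain n) :=
  ContDiffOn.continuousOn_fderivWithin hf (uniqueDiffOn_domain n) (by simp)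

theorem IsSmoothPath.continuousOn (hf : IsSmoothPath f) : ContinuousOn (total f) (domain n) :=
  ContDiffOn.continuousOn hf

theorem hasFDerivAt_diff (φ : Diff n) (p : Space n) : HasFDerivAt φ (fderiv ℝ φ p) p :=
  (φ.contDiff.differentiable (by simp) p).hasFDerivAt

theorem IsSmoothPath.fderivWithin_inr (hf : IsSmoothPath f) {t : ℝ} (ht : t ∈ Icc (0 : ℝ) 1)
    (p : Space n) : (fderivWithin ℝ (total f) (domain n) (t, p)).comp
      (ContinuousLinearMap.inr ℝ ℝ (Space n)) = fderiv ℝ (f t) p := by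
  have h1 : HasFDerivAt (fun p : Space n => (t, p)) (ContinuousLinearMap.inr ℝ ℝ (Space n)) p :=
    hasFDerivAt_prodMk_right t p
  have hmaps : MapsTo (fun p : Space n => (t, p)) univ (domain n) :=
    fun q _ => ⟨ht, mem_univ q⟩
  have h2 := HasFDerivWithinAt.comp (f := fun p : Space n => (t, p)) p
    (hf.hasFDerivWithinAt ht p) h1.hasFDerivWithinAt hmaps
  rw [hasFDerivWithinAt_univ] at h2
  exact h2.unique (hasFDerivAt_diff (f t) p)

/-- The velocity of the composition of a path of diffeomorphisms with a moving point. -/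
theorem IsSmoothPath.hasDerivWithinAt_comp (hf : IsSmoothPath f) {t : ℝ}
    (ht : t ∈ Icc (0 : ℝ) 1) {c : ℝ → Space n} {v : Space n} (hc : HasDerivAt c v t) :
    HasDerivWithinAt (fun s => f s (c s))
      (fderivWithin ℝ (total f) (domain n) (t, c t) (1, 0) + fderiv ℝ (f t) (c t) v)
      (Icc 0 1) t := by
  have h1 : HasDerivWithinAt (fun s => (s, c s)) ((1 : ℝ), v) (Icc 0 1) t :=
    ((hasDerivAt_id t).prodMk hc).hasDerivWithinAt
  have hmaps : MapsTo (fun s => (s, c s)) (Icc (0 : ℝ) 1) (domain n) :=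
    fun s hs => ⟨hs, mem_univ _⟩
  have h2 := HasFDerivWithinAt.comp_hasDerivWithinAt (f := fun s => (s, c s)) t
    (hf.hasFDerivWithinAt ht (c t)) h1 hmaps
  have h3 : fderivWithin ℝ (total f) (domain n) (t, c t) (1, v) =
      fderivWithin ℝ (total f) (domain n) (t, c t) (1, 0) + fderiv ℝ (f t) (c t) v := by
    rw [← hf.fderivWithin_inr ht, ContinuousLinearMap.comp_apply, ← map_add]
    simp
  rw [h3] at h2
  exact h2

theorem IsSmoothPath.vectorField_eq (hf : IsSmoothPath f) {t : ℝ} (ht : t ∈ Icc (0 : ℝ) 1)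
    (p : Space n) :
    vectorField f t (f t p) = fderivWithin ℝ (total f) (domain n) (t, p) (1, 0) := by
  have h := hf.hasDerivWithinAt_comp ht (hasDerivAt_const t p)
  rw [map_zero, add_zero] at h
  have h2 : (f t).symm (f t p) = p := (f t).symm_apply_apply p
  simp only [vectorField, h2]
  exact h.derivWithin (uniqueDiffOn_Icc zero_lt_one t ht)

theorem surjective_fderiv (φ : Diff n) (p : Space n) :
    Function.Surjective (fderiv ℝ φ p) := by
  intro w
  have h1 : HasFDerivAt φ.symm (fderiv ℝ φ.symm (φ p)) (φ p) := hasFDerivAt_diff _ _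
  have hp : φ.symm (φ p) = p := φ.symm_apply_apply p
  have h2 : HasFDerivAt φ (fderiv ℝ φ p) (φ.symm (φ p)) := by
    rw [hp]; exact hasFDerivAt_diff φ p
  have h3 := h2.comp (φ p) h1
  have h4 : φ ∘ φ.symm = id := funext fun y => φ.apply_symm_apply y
  rw [h4] at h3
  have h5 := h3.unique (hasFDerivAt_id (φ p))
  exact ⟨fderiv ℝ φ.symm (φ p) w, congrArg (fun l : Space n →L[ℝ] Space n => l w) h5⟩

/-- The inverses of a path of diffeomorphisms over `[0, 1]` are uniformly bounded on compact sets.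
Locally in time, the quantitative form of the inverse function theorem yields preimages in a fixed
ball. -/
theorem IsSmoothPath.exists_bound_preimage (hf : IsSmoothPath f) {K : Set (Space n)}
    (hK : IsCompact K) :
    ∃ R : ℝ, ∀ t ∈ Icc (0 : ℝ) 1, ∀ p, f t p ∈ K → ‖p‖ ≤ R := by
  have hcomp : IsCompact (Icc (0 : ℝ) 1 ×ˢ K) := isCompact_Icc.prod hK
  suffices h : ∃ R : ℝ, ∀ y ∈ Icc (0 : ℝ) 1 ×ˢ K, ‖(f y.1).symm y.2‖ ≤ R by
    obtain ⟨R, hR⟩ := h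
    refine ⟨R, fun t ht p hp => ?_⟩
    have := hR (t, f t p) ⟨ht, hp⟩
    simpa using this
  refine hcomp.induction_on (p := fun s => ∃ R : ℝ, ∀ y ∈ s, ‖(f y.1).symm y.2‖ ≤ R)
    ⟨0, by simp⟩ (fun s t hst ⟨R, hR⟩ => ⟨R, fun y hy => hR y (hst hy)⟩)
    (fun s t ⟨R, hR⟩ ⟨R', hR'⟩ => ⟨max R R', fun y hy => ?_⟩) ?_
  · rcases hy with hy | hy
    · exact (hR y hy).trans (le_max_left _ _)
    · exact (hR' y hy).trans (le_max_right _ _)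
  rintro ⟨t₀, y₀⟩ ⟨ht₀, -⟩
  simp only at ht₀
  set p₀ := (f t₀).symm y₀ with hp₀
  have hfp₀ : f t₀ p₀ = y₀ := (f t₀).apply_symm_apply y₀
  set A := fderiv ℝ (f t₀) p₀ with hA
  have hAsurj : A.range = ⊤ := LinearMap.range_eq_top.2 (surjective_fderiv (f t₀) p₀)
  let S := A.nonlinearRightInverseOfSurjective hAsurj
  have hS : 0 < S.nnnorm := A.nonlinearRightInverseOfSurjective_nnnorm_pos hAsurj
  let c : NNReal := S.nnnorm⁻¹ / 2
  have hc : 0 < c := by positivity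
  -- near `(t₀, p₀)` the differentials of the diffeomorphisms are close to `A`
  have hnear : ∃ r > 0, ∀ t ∈ Icc (0 : ℝ) 1, |t - t₀| ≤ r → ∀ p ∈ Metric.closedBall p₀ r,
      ‖fderiv ℝ (f t) p - A‖ ≤ c := by
    have h1 : ContinuousOn (fun y : ℝ × Space n =>
        (fderivWithin ℝ (total f) (domain n) y).comp (ContinuousLinearMap.inr ℝ ℝ (Space n)))
        (domain n) := hf.continuousOn_fderivWithin.clm_comp continuousOn_const
    obtain ⟨r, hr, h2⟩ := Metric.continuousOn_iff.1 h1 (t₀, p₀) ⟨ht₀, mem_univ _⟩ c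
      (NNReal.coe_pos.2 hc)
    refine ⟨r / 2, by positivity, fun t ht htr p hp => ?_⟩
    have h3 := h2 (t, p) ⟨ht, mem_univ _⟩ (by
      rw [Prod.dist_eq, max_lt_iff]
      rw [Metric.mem_closedBall] at hp
      exact ⟨by rw [Real.dist_eq]; linarith, by linarith⟩)
    rw [hf.fderivWithin_inr ht, hf.fderivWithin_inr ht₀, dist_eq_norm] at h3
    exact h3.le
  obtain ⟨r, hr, hnear⟩ := hnear
  have happrox : ∀ t ∈ Icc (0 : ℝ) 1, |t - t₀| ≤ r →
      ApproximatesLinearOn (f t) A (Metric.closedBall p₀ r) c := by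
    intro t ht htr x hx y hy
    exact (convex_closedBall p₀ r).norm_image_sub_le_of_norm_hasFDerivWithin_le'
      (fun p _ => (hasFDerivAt_diff (f t) p).hasFDerivWithinAt) (hnear t ht htr) hy hx
  set ρ : ℝ := ((S.nnnorm : ℝ)⁻¹ - c) * r with hρ
  have hρ0 : 0 < ρ := by
    have : (c : ℝ) = (S.nnnorm : ℝ)⁻¹ / 2 := by simp [c]
    have h2 : 0 < (S.nnnorm : ℝ)⁻¹ := inv_pos.2 (NNReal.coe_pos.2 hS)
    apply mul_pos _ hr
    rw [this]; linarith
  have hcont : ContinuousWithinAt (fun t => f t p₀) (Icc 0 1) t₀ := by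
    have h1 := hf.continuousOn (t₀, p₀) ⟨ht₀, mem_univ _⟩
    exact ContinuousWithinAt.comp (f := fun t : ℝ => (t, p₀)) (g := total f) h1
      (by fun_prop) (fun t ht => ⟨ht, mem_univ _⟩)
  have hev : ∀ᶠ t in nhdsWithin t₀ (Icc (0 : ℝ) 1), dist (f t p₀) y₀ < ρ / 2 := by
    have := hcont.tendsto
    rw [hfp₀] at this
    exact (Metric.tendsto_nhds.1 this) _ (by positivity)
  have hev2 : ∀ᶠ t in nhdsWithin t₀ (Icc (0 : ℝ) 1), |t - t₀| ≤ r := by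
    filter_upwards [nhdsWithin_le_nhds (Metric.closedBall_mem_nhds t₀ hr)] with t ht
    exact ht
  have hev3 : ∀ᶠ t in nhdsWithin t₀ (Icc (0 : ℝ) 1), t ∈ Icc (0 : ℝ) 1 := self_mem_nhdsWithin
  have hevy : ∀ᶠ y in nhdsWithin y₀ K, dist y y₀ < ρ / 2 :=
    nhdsWithin_le_nhds (Metric.ball_mem_nhds y₀ (by positivity))
  refine ⟨{y | ‖(f y.1).symm y.2‖ ≤ ‖p₀‖ + r}, ?_, ‖p₀‖ + r, fun y hy => hy⟩
  rw [nhdsWithin_prod_eq]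
  filter_upwards [((hev.and hev2).and hev3).prod_mk hevy]
  rintro ⟨t, y⟩ ⟨⟨⟨h1, h2⟩, h3⟩, h4⟩
  simp only at h1 h2 h3 h4
  have hsurj := (happrox t h3 h2).surjOn_closedBall_of_nonlinearRightInverse S hr.le Subset.rfl
  obtain ⟨p, hp, hpy⟩ := hsurj (show y ∈ Metric.closedBall (f t p₀) ρ by
    rw [Metric.mem_closedBall]
    linarith [dist_triangle_right y (f t p₀) y₀])
  have : (f t).symm y = p := by rw [← hpy]; exact (f t).symm_apply_apply p
  show ‖(f t).symm y‖ ≤ ‖p₀‖ + r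
  rw [this]
  rw [mem_closedBall_iff_norm] at hp
  linarith [norm_le_norm_add_norm_sub' p p₀]

/-! ### The conformal factor and the Hamiltonian of a contact path -/

/-- The conformal factor `λ` with `(f t)^* α₀ = λ α₀`, when `f t` is a contactomorphism: since
`α₀ (∂/∂z) = 1`, it is the value of `(f t)^* α₀` on `∂/∂z`. -/
noncomputable def factor (f : ℝ → Diff n) (y : ℝ × Space n) : ℝ :=
  form n (total f y) (fderivWithin ℝ (total f) (domain n) y (0, dirZ n))

/-- The function `α₀ (X_t)` along a path, at the point `f t p`. -/
noncomputable def speed (f : ℝ → Diff n) (y : ℝ × Space n) : ℝ :=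
  form n (total f y) (fderivWithin ℝ (total f) (domain n) y (1, 0))

theorem continuous_form (n : ℕ) : Continuous (form n) := by
  unfold form
  fun_prop

theorem IsSmoothPath.continuousOn_factor (hf : IsSmoothPath f) :
    ContinuousOn (factor f) (domain n) :=
  ((continuous_form n).comp_continuousOn hf.continuousOn).clm_apply
    (hf.continuousOn_fderivWithin.clm_apply continuousOn_const)

theorem IsSmoothPath.continuousOn_speed (hf : IsSmoothPath f) :
    ContinuousOn (speed f) (domain n) :=
  ((continuous_form n).comp_continuousOn hf.continuousOn).clm_apply
    (hf.continuousOn_fderivWithin.clm_apply continuousOn_const)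

theorem IsSmoothPath.factor_eq (hf : IsSmoothPath f) {t : ℝ} (ht : t ∈ Icc (0 : ℝ) 1)
    (p : Space n) : factor f (t, p) = form n (f t p) (fderiv ℝ (f t) p (dirZ n)) := by
  rw [← hf.fderivWithin_inr ht]; rfl

theorem IsSmoothPath.form_fderiv (hf : IsSmoothPath f) {t : ℝ} (ht : t ∈ Icc (0 : ℝ) 1)
    (hc : IsContacto (f t)) (p v : Space n) :
    form n (f t p) (fderiv ℝ (f t) p v) = factor f (t, p) * form n p v := by
  -- `v` splits into a contact vector and a multiple of `∂/∂z`
  have h1 : v - form n p v • dirZ n ∈ structureAt n p := by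
    simp [structureAt]
  have h2 : fderiv ℝ (f t) p (v - form n p v • dirZ n) ∈ structureAt n (f t p) := by
    rw [← hc p]
    exact Submodule.mem_map_of_mem h1
  have h3 : form n (f t p) (fderiv ℝ (f t) p (v - form n p v • dirZ n)) = 0 := h2
  rw [map_sub, map_sub, map_smul, map_smul, sub_eq_zero, smul_eq_mul] at h3
  rw [h3, hf.factor_eq ht, mul_comm]

theorem IsSmoothPath.factor_ne_zero (hf : IsSmoothPath f) {t : ℝ} (ht : t ∈ Icc (0 : ℝ) 1)
    (hc : IsContacto (f t)) (p : Space n) : factor f (t, p) ≠ 0 := by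
  intro h0
  obtain ⟨v, hv⟩ := surjective_fderiv (f t) p (dirZ n)
  have := hf.form_fderiv ht hc p v
  rw [hv, form_dirZ, h0, zero_mul] at this
  exact one_ne_zero this

/-- The conformal factor never vanishes, so it has a constant sign `σ`. -/
theorem IsSmoothPath.exists_sign (hf : IsSmoothPath f)
    (hc : ∀ t ∈ Icc (0 : ℝ) 1, IsContacto (f t)) :
    ∃ σ : ℝ, |σ| = 1 ∧ ∀ y ∈ domain n, 0 < factor f y * σ := by
  have hpre : IsPreconnected (domain n) := isPreconnected_Icc.prod isPreconnected_univ
  have hne : ∀ y ∈ domain n, factor f y ≠ 0 := fun y hy => hf.factor_ne_zero hy.1 (hc _ hy.1) y.2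
  have himg := hpre.image _ hf.continuousOn_factor
  by_cases h : ∃ y ∈ domain n, 0 < factor f y
  · obtain ⟨y, hy, hy0⟩ := h
    refine ⟨1, by simp, fun z hz => ?_⟩
    rw [mul_one]
    by_contra! hz0
    obtain ⟨x, hx, hx0⟩ := himg.ordConnected.out (mem_image_of_mem _ hz) (mem_image_of_mem _ hy)
      ⟨hz0, hy0.le⟩
    exact hne x hx hx0
  · push Not at h
    refine ⟨-1, by simp, fun z hz => ?_⟩
    have := lt_of_le_of_ne (h z hz) (hne z hz)
    linarith

/-! ### Making the path positive -/

/-- The positive path is `f t ∘ H t` for a loop `H` supported in the ball of radius `R'`. If `H`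
moves up fast enough in the ball of radius `R`, it outweighs the negative part of `α₀ (X_t)`; if it
sinks slowly enough elsewhere, the positive lower bound of `α₀ (X_t)` on the shell between the two
radii absorbs the loss. -/
theorem IsSmoothPath.exists_positive_path (hf : IsSmoothPath f) (i : Fin n)
    (hcont : ∀ t ∈ Icc (0 : ℝ) 1, IsContacto (f t))
    {K₁ : Set (Space n)} (hK₁ : IsCompact K₁) (hpos : IsPositiveOn f K₁ᶜ) :
    ∃ g : ℝ → Diff n, IsSmoothPath g ∧ IsPositiveOn g univ ∧ g 0 = f 0 ∧ g 1 = f 1 ∧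
      ∃ K₂ : Set (Space n), IsCompact K₂ ∧ K₁ ⊆ K₂ ∧
        ∀ t ∈ Icc (0 : ℝ) 1, ∀ p ∈ K₂ᶜ, g t p = f t p := by
  obtain ⟨R₀, hR₀⟩ := hf.exists_bound_preimage hK₁
  set R := max R₀ 0 + 1
  have hR : 1 ≤ R := by linarith [le_max_right R₀ 0]
  have hspeed : ∀ t ∈ Icc (0 : ℝ) 1, ∀ p, R ≤ ‖p‖ → 0 < speed f (t, p) := by
    intro t ht p hp
    have h1 : f t p ∉ K₁ := fun h => by
      linarith [hR₀ t ht p h, le_max_left R₀ 0]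
    have h2 := hpos t ht (f t p) h1
    rw [hf.vectorField_eq ht] at h2
    exact h2
  set R' := 4 * R + 2 with hR'
  have hcb : IsCompact (Icc (0 : ℝ) 1 ×ˢ Metric.closedBall (0 : Space n) R') :=
    isCompact_Icc.prod (isCompact_closedBall _ _)
  have hsub : Icc (0 : ℝ) 1 ×ˢ Metric.closedBall (0 : Space n) R' ⊆ domain n :=
    prod_mono_right (subset_univ _)
  obtain ⟨σ, hσ, hsign⟩ := hf.exists_sign hcont
  have hfac := hf.continuousOn_factor.mono hsub
  have hspc := hf.continuousOn_speed.mono hsub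
  have h0mem : ((0 : ℝ), (0 : Space n)) ∈ Icc (0 : ℝ) 1 ×ˢ Metric.closedBall (0 : Space n) R' :=
    ⟨⟨le_rfl, zero_le_one⟩, Metric.mem_closedBall_self (by linarith)⟩
  obtain ⟨a, ha0, ha⟩ : ∃ a > 0, ∀ y ∈ Icc (0 : ℝ) 1 ×ˢ Metric.closedBall (0 : Space n) R',
      a ≤ factor f y * σ := by
    obtain ⟨y, hy, hmin⟩ := hcb.exists_isMinOn ⟨_, h0mem⟩ (hfac.mul continuousOn_const)
    exact ⟨_, hsign y (hsub hy), fun z hz => hmin hz⟩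
  obtain ⟨b, hb⟩ : ∃ b, ∀ y ∈ Icc (0 : ℝ) 1 ×ˢ Metric.closedBall (0 : Space n) R',
      factor f y * σ ≤ b := by
    obtain ⟨y, hy, hmax⟩ := hcb.exists_isMaxOn ⟨_, h0mem⟩ (hfac.mul continuousOn_const)
    exact ⟨_, fun z hz => hmax hz⟩
  have hb0 : 0 < b := ha0.trans_le ((ha _ h0mem).trans (hb _ h0mem))
  obtain ⟨M, hM⟩ : ∃ M, ∀ y ∈ Icc (0 : ℝ) 1 ×ˢ Metric.closedBall (0 : Space n) R',
      -M ≤ speed f y := by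
    obtain ⟨y, hy, hmin⟩ := hcb.exists_isMinOn ⟨_, h0mem⟩ hspc
    exact ⟨-speed f y, fun z hz => by rw [neg_neg]; exact hmin hz⟩
  -- a positive lower bound of the speed on the shell between the radii `R` and `R'`
  obtain ⟨m, hm0, hm⟩ : ∃ m > 0, ∀ t ∈ Icc (0 : ℝ) 1, ∀ p, R ≤ ‖p‖ → ‖p‖ ≤ R' →
      m ≤ speed f (t, p) := by
    have hclosed : IsClosed {y : ℝ × Space n | R ≤ ‖y.2‖} :=
      isClosed_le continuous_const (by fun_prop)
    have hsc := hcb.inter_right hclosed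
    rcases (Icc (0 : ℝ) 1 ×ˢ Metric.closedBall (0 : Space n) R' ∩
      {y : ℝ × Space n | R ≤ ‖y.2‖}).eq_empty_or_nonempty with he | hne
    · refine ⟨1, one_pos, fun t ht p hp hp' => ?_⟩
      have : (t, p) ∈ (∅ : Set (ℝ × Space n)) := by
        rw [← he]
        exact ⟨⟨ht, by rw [mem_closedBall_zero_iff]; exact hp'⟩, hp⟩
      exact absurd this (notMem_empty _)
    · obtain ⟨y, hy, hmin⟩ := hsc.exists_isMinOn hne (hspc.mono inter_subset_left)
      exact ⟨_, hspeed y.1 hy.1.1 y.2 hy.2, fun t ht p hp hp' =>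
        hmin ⟨⟨ht, by rw [mem_closedBall_zero_iff]; exact hp'⟩, hp⟩⟩
  obtain ⟨H, hH, hHd, hH0, hH1, hHs, hHt⟩ :=
    exists_loop i hR hσ (δ := m / (2 * b)) (by positivity) ((|M| + 1) / a)
  have hg : ∀ t : ℝ, ∃ Ψ : Diff n, t ∈ Icc (0 : ℝ) 1 → ∀ q, Ψ q = f t (H (t, q)) := by
    intro t
    by_cases ht : t ∈ Icc (0 : ℝ) 1
    · obtain ⟨Ψ, hΨ⟩ := hHd t ht
      exact ⟨Ψ.trans (f t), fun _ q => by simp [hΨ]⟩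
    · exact ⟨f t, fun h => absurd h ht⟩
  choose g hg using hg
  have hends : ∀ t ∈ Icc (0 : ℝ) 1, (∀ q, H (t, q) = q) → g t = f t := fun t ht h =>
    Diffeomorph.ext fun q => by rw [hg t ht, h]
  refine ⟨g, ?_, ?_, hends 0 ⟨le_rfl, zero_le_one⟩ hH0, hends 1 ⟨zero_le_one, le_rfl⟩ hH1,
    K₁ ∪ Metric.closedBall 0 R', hK₁.union (isCompact_closedBall _ _), subset_union_left, ?_⟩
  · have h1 : ContDiffOn ℝ ∞ (fun y : ℝ × Space n => (y.1, H y)) (domain n) :=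
      (contDiff_fst.prodMk hH).contDiffOn
    have h2 : ContDiffOn ℝ ∞ (fun y : ℝ × Space n => total f (y.1, H y)) (domain n) :=
      ContDiffOn.comp (g := total f) hf h1 fun y hy => ⟨hy.1, mem_univ _⟩
    exact h2.congr fun y hy => hg y.1 hy.1 y.2
  · intro t ht x _
    obtain ⟨q, rfl⟩ : ∃ q, g t q = x := (g t).surjective x
    obtain ⟨v, w, hv, hvw, hw1, hw2⟩ := hHt t ht q
    have hvf : vectorField g t (g t q) =
        fderivWithin ℝ (total f) (domain n) (t, H (t, q)) (1, 0) +
          fderiv ℝ (f t) (H (t, q)) v := by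
      have h2 : (g t).symm (g t q) = q := (g t).symm_apply_apply q
      simp only [vectorField, h2]
      exact ((hf.hasDerivWithinAt_comp ht hv).congr (fun s hs => hg s hs q)
        (hg t ht q)).derivWithin (uniqueDiffOn_Icc zero_lt_one t ht)
    have hval : form n (g t q) (vectorField g t (g t q)) =
        speed f (t, H (t, q)) + factor f (t, H (t, q)) * σ * w := by
      rw [hvf, hg t ht, map_add, hf.form_fderiv ht (hcont t ht), hvw, mul_assoc]
      rfl
    rw [hval]
    set p := H (t, q) with hp
    rcases lt_or_ge R' ‖p‖ with hfar | hnear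
    · -- far away `H` is constant in time, so `w = 0`
      have hqp : q = p := by
        obtain ⟨Ψ, hΨ⟩ := hHd t ht
        have h1 : Ψ q = Ψ p := by rw [hΨ, hΨ, hHs t p hfar.le]
        exact Ψ.injective h1
      have hv0 : v = 0 := by
        have h1 : (fun s => H (s, q)) = fun _ => q := by
          funext s
          exact hHs s q (by rw [hqp]; exact hfar.le)
        rw [h1] at hv
        exact hv.unique (hasDerivAt_const _ _)
      have hσw : σ * w = 0 := by rw [← hvw, hv0, map_zero]
      rw [mul_assoc, hσw, mul_zero, add_zero]
      exact hspeed t ht p (by linarith)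
    have hmem : (t, p) ∈ Icc (0 : ℝ) 1 ×ˢ Metric.closedBall (0 : Space n) R' :=
      ⟨ht, by rw [mem_closedBall_zero_iff]; exact hnear⟩
    have ha' := ha _ hmem
    have hb' := hb _ hmem
    set k := factor f (t, p) * σ
    rcases le_or_gt ‖p‖ R with hin | hout
    · have h1 : (|M| + 1) / a ≤ w := hw2 hin
      have h2 : |M| + 1 ≤ k * w := by
        rw [div_le_iff₀ ha0] at h1
        have : 0 ≤ w := by
          by_contra! hw
          nlinarith [abs_nonneg M]
        nlinarith
      linarith [hM _ hmem, le_abs_self M]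
    · have h1 := hm t ht p hout.le hnear
      have h2 : -(m / 2) ≤ k * w := by
        have h3 : k * (-(m / (2 * b))) ≤ k * w := by gcongr; linarith
        have h4 : k * (m / (2 * b)) ≤ b * (m / (2 * b)) := by gcongr
        have h5 : b * (m / (2 * b)) = m / 2 := by field_simp
        linarith
      linarith
  · intro t ht p hp
    rw [hg t ht, hHs t p]
    by_contra! h
    exact hp (Or.inr (by rw [mem_closedBall_zero_iff]; exact h.le))

end StdContact

theorem mainTheorem3 (n : ℕ) (hn : 1 ≤ n) (f : ℝ → StdContact.Diff n)
    (hf : StdContact.IsSmoothPath f)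
    (hcont : ∀ t ∈ Set.Icc (0 : ℝ) 1, StdContact.IsContacto (f t))
    (K₁ : Set (StdContact.Space n)) (hK₁ : IsCompact K₁)
    (hpos : StdContact.IsPositiveOn f K₁ᶜ) :
    ∃ g : ℝ → StdContact.Diff n,
      StdContact.IsSmoothPath g ∧
      StdContact.IsPositiveOn g Set.univ ∧
      g 0 = f 0 ∧ g 1 = f 1 ∧
      ∃ K₂ : Set (StdContact.Space n), IsCompact K₂ ∧ K₁ ⊆ K₂ ∧
        ∀ t ∈ Set.Icc (0 : ℝ) 1, ∀ p ∈ K₂ᶜ, g t p = f t p :=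
  hf.exists_positive_path ⟨0, hn⟩ hcont hK₁ hpos
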